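/- Let $\Omega\subseteq\mathbb R^3$ be open and let $\mathcal V$ be a smooth unit anti-torqued vector field on $\Omega$ with smooth, nowhere vanishing conformal scalar $f$; that is, $|\mathcal V|=1$ and $\nabla^0_X\mathcal V=f\,(X-\langle X,\mathcal V\rangle\mathcal V)$ for all $X$, where $\nabla^0$ is the Levi-Civita connection of $\mathbb R^3$. Let $\phi:N\to\Omega$ be a smooth immersion of a smooth surface $N$ with smooth unit normal field $U$, and let $\theta\in[0,\pi]$ be a constant such that $\langle U,\mathcal V\rangle=\cos\theta$ on $N$, the tangential component $\mathcal V^\top$ of $\mathcal V$ vanishes nowhere on $N$ (hence $\sin\theta\neq0$ if $N\ne\emptyset$), and $\cos\theta\neq0$. Put $T=\mathcal V^\top/|\mathcal V^\top|$, and let $A(X)=-\nabla^0_XU$ be the shape operator of $N$. Then every point of $N$ has a neighbourhood with smooth local coordinates $(s,t)$, ranging over an open rectangle $I\times J$, in which $\partial_s=T$ and the induced metric is $ds^2+\lambda^2dt^2$, $\lambda=|\partial_t|>0$. In every such coordinate system, $f\circ\phi=f(s)$ depends only on $s$, the vectors $\partial_s$ and $\partial_t$ are principal directions, and the corresponding principal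 curvatures $\kappa_1,\kappa_2$ (with $A\partial_s=\kappa_1\partial_s$, $A\partial_t=\kappa_2\partial_t$) satisfy $$\kappa_1(s)=-\cos\theta\,f(s),$$ $$\partial_s\kappa_2(s,t)=-\frac{1}{\sin\theta}\,\bigl(\cos\theta\, f(s)+\kappa_2(s,t)\bigr)\bigl(\cos\theta\,\kappa_2(s,t)+f(s)\bigr).$$ -/

import Mathlib

open scoped Manifold ContDiff RealInnerProductSpace

noncomputable section

/-- Euclidean three-space. -/
abbrev E3 : Type := EuclideanSpace ℝ (Fin 3)

/-- The model (coordinate) plane of a smooth surface. -/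
abbrev E2 : Type := EuclideanSpace ℝ (Fin 2)

/-- `V` is a smooth torse-forming vector field on the open set `Ω` of Euclidean space, with
conformal scalar `f` and generating form `η`: `∇⁰_X V = f X + η(X) V`.
The Levi-Civita connection of Euclidean space is the usual directional derivative. -/
structure IsTorseForming (Ω : Set E3) (V : E3 → E3) (f : E3 → ℝ) (η : E3 → E3 →L[ℝ] ℝ) :
    Prop where
  contDiffOn_field : ContDiffOn ℝ ∞ V Ω
  contDiffOn_scalar : ContDiffOn ℝ ∞ f Ω
  contDiffOn_form : ContDiffOn ℝ ∞ η Ω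
  fderiv_eq : ∀ x ∈ Ω, ∀ X : E3, fderiv ℝ V x X = f x • X + η x X • V x

/-- `V` is a unit anti-torqued vector field on `Ω` with conformal scalar `f`: it has length one
and is torse-forming, its generating form is `-f ν` with `ν = ⟨V, ·⟩`, and `f` has no zero. -/
structure IsUnitAntiTorqued (Ω : Set E3) (V : E3 → E3) (f : E3 → ℝ) : Prop where
  torseForming : IsTorseForming Ω V f (fun x => (-f x) • innerSL ℝ (V x))
  norm_eq_one : ∀ x ∈ Ω, ‖V x‖ = 1
  scalar_ne_zero : ∀ x ∈ Ω, f x ≠ 0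

/-- A smooth surface `N` immersed in Euclidean three-space and oriented by the choice of a smooth
unit normal field along the immersion. -/
structure OrientedSurface (N : Type*) [TopologicalSpace N] [ChartedSpace E2 N] where
  /-- the immersion -/
  φ : N → E3
  /-- the unit normal field -/
  U : N → E3
  contMDiff_φ : ContMDiff (𝓡 2) 𝓘(ℝ, E3) ∞ φ
  contMDiff_U : ContMDiff (𝓡 2) 𝓘(ℝ, E3) ∞ U
  injective_mfderiv : ∀ p : N, Function.Injective (mfderiv (𝓡 2) 𝓘(ℝ, E3) φ p)
  norm_U : ∀ p : N, ‖U p‖ = 1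
  inner_U : ∀ (p : N) (X : TangentSpace (𝓡 2) p),
    inner ℝ (U p) (mfderiv (𝓡 2) 𝓘(ℝ, E3) φ p X : E3) = 0

namespace OrientedSurface

variable {N : Type*} [TopologicalSpace N] [ChartedSpace E2 N] (S : OrientedSurface N)

/-- The differential `dφ_p : T_pN → ℝ³` of the immersion. -/
def dφ (p : N) : TangentSpace (𝓡 2) p →ₗ[ℝ] E3 :=
  (mfderiv (𝓡 2) 𝓘(ℝ, E3) S.φ p : TangentSpace (𝓡 2) p →L[ℝ] E3).toLinearMap

/-- The derivative `X ↦ ∇⁰_X U` of the unit normal along the surface. -/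
def dU (p : N) : TangentSpace (𝓡 2) p →ₗ[ℝ] E3 :=
  (mfderiv (𝓡 2) 𝓘(ℝ, E3) S.U p : TangentSpace (𝓡 2) p →L[ℝ] E3).toLinearMap

theorem injective_dφ (p : N) : Function.Injective (S.dφ p) :=
  S.injective_mfderiv p

/-- The induced Riemannian metric on `N`. -/
def metric (p : N) (X Y : TangentSpace (𝓡 2) p) : ℝ :=
  inner ℝ (S.dφ p X) (S.dφ p Y)

/-- The tangential projection `ℝ³ → T_pN`: project a vector orthogonally onto the image of `dφ_p`
and take its preimage under `dφ_p`. -/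
def tangential (p : N) : E3 →ₗ[ℝ] TangentSpace (𝓡 2) p :=
  (LinearEquiv.ofInjective (S.dφ p) (S.injective_dφ p)).symm.toLinearMap ∘ₗ
    (LinearMap.range (S.dφ p)).orthogonalProjectionOnto.toLinearMap

/-- The shape operator `A(X) = -∇⁰_X U` of `N`. The vector `∇⁰_X U` is orthogonal to `U`, hence in
the image of `dφ_p`, so that the tangential projection only identifies it with a vector
of `T_pN`. -/
def shapeOperator (p : N) : Module.End ℝ (TangentSpace (𝓡 2) p) :=
  -(S.tangential p ∘ₗ S.dU p)

/-- The tangential component `V^⊤` of an ambient vector field along `N`. -/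
def tangentPart (V : E3 → E3) (p : N) : TangentSpace (𝓡 2) p :=
  S.tangential p (V (S.φ p))

/-- `T = V^⊤ / |V^⊤|`. -/
def unitTangentPart (V : E3 → E3) (p : N) : TangentSpace (𝓡 2) p :=
  (Real.sqrt (S.metric p (S.tangentPart V p) (S.tangentPart V p)))⁻¹ • S.tangentPart V p

/-- `N` lies in `Ω`, it makes the constant angle `θ` with the axis `V`, and `V^⊤` has no zero on
`N`. -/
structure IsConstantAngle (Ω : Set E3) (V : E3 → E3) (θ : ℝ) : Prop where
  mem : ∀ p : N, S.φ p ∈ Ω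
  angle_mem : θ ∈ Set.Icc 0 Real.pi
  inner_eq : ∀ p : N, inner ℝ (S.U p) (V (S.φ p)) = Real.cos θ
  tangentPart_ne_zero : ∀ p : N, S.tangentPart V p ≠ 0

end OrientedSurface

section Coordinates

variable {N : Type*} [TopologicalSpace N] [ChartedSpace E2 N]

/-- The point of `N` with coordinates `(s, t)` in the chart `e`. -/
def chartPoint (e : OpenPartialHomeomorph N E2) (s t : ℝ) : N :=
  e.symm !₂[s, t]

/-- The coordinate vector `∂_s` of the chart `e` at the point with coordinates `(s, t)`. -/
def chartS (e : OpenPartialHomeomorph N E2) (s t : ℝ) :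
    TangentSpace (𝓡 2) (chartPoint e s t) :=
  mfderiv (𝓡 2) (𝓡 2) e.symm !₂[s, t] (!₂[(1 : ℝ), 0] : E2)

/-- The coordinate vector `∂_t` of the chart `e` at the point with coordinates `(s, t)`. -/
def chartT (e : OpenPartialHomeomorph N E2) (s t : ℝ) :
    TangentSpace (𝓡 2) (chartPoint e s t) :=
  mfderiv (𝓡 2) (𝓡 2) e.symm !₂[s, t] (!₂[(0 : ℝ), 1] : E2)

/-- The smooth chart `e` of `N` is a coordinate system `(s, t)` with values in the open rectangle
`I × J` for which `∂_s = T` and `∂_t` is orthogonal to `T`. As `T` is a unit vector, this means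
that `∂_s = T` and that the induced metric is `ds² + λ² dt²` with `λ = |∂_t| > 0`. -/
structure OrientedSurface.IsAdaptedChart (S : OrientedSurface N) (V : E3 → E3)
    (e : OpenPartialHomeomorph N E2) (I J : Set ℝ) : Prop where
  mem_maximalAtlas : e ∈ IsManifold.maximalAtlas (𝓡 2) ∞ N
  isOpen_left : IsOpen I
  isOpen_right : IsOpen J
  ordConnected_left : I.OrdConnected
  ordConnected_right : J.OrdConnected
  target_eq : e.target = {z : E2 | z 0 ∈ I ∧ z 1 ∈ J}
  chartS_eq : ∀ s ∈ I, ∀ t ∈ J, chartS e s t = S.unitTangentPart V (chartPoint e s t)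
  orthogonal : ∀ s ∈ I, ∀ t ∈ J, S.metric (chartPoint e s t) (chartS e s t) (chartT e s t) = 0

end Coordinates

end

/-! Write ν = ⟨V, ·⟩. Equality of the mixed second derivatives of V forces df = -f² ν, that is,
d(1/f) = ν (`IsUnitAntiTorqued.fderiv_scalar`). Along the surface V = sin θ T + cos θ U, so ν(T) =
sin θ and ν vanishes on the tangent directions orthogonal to T.

Curvatures: differentiating ⟨U, V⟩ = cos θ and using the symmetry of the second fundamental form
gives dU(T) = cos θ f T, so T and its orthogonal complement are principal (`fderiv_normal_axis`,
`fderiv_normal_cross`). In adapted coordinates f is constant in t, and the equation for κ₂ is the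
Codazzi equation: compare ∂_t∂_s U with ∂_s∂_t U, and compute ∂_t∂_s φ from sin θ ∂_s φ = V - cos θ
U (`fderiv_normalCurvature`).

Coordinates: no flow is integrated, since both coordinates are explicit. The function s = 1/(f sin
θ) has ds(T) = 1 and kills T^⊥. For t, a component of U ∧ V is taken: U ∧ V is constant along T, and
its derivative across T does not vanish because f ≠ 0 and sin θ ≠ 0. The inverse function theorem
applied to (s, t) gives the chart (`exists_adapted`).

All of this is calculus on an open subset of the plane (`IsConstantAnglePatch`), then transported to
N through its charts. -/

/-- A vector of `E3` orthogonal to three nonzero pairwise orthogonal vectors vanishes. -/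
theorem eq_zero_of_orthogonal_triple {a b c d : E3} (ha : a ≠ 0) (hb : b ≠ 0) (hc : c ≠ 0)
    (hab : ⟪a, b⟫ = 0) (hac : ⟪a, c⟫ = 0) (hbc : ⟪b, c⟫ = 0)
    (had : ⟪a, d⟫ = 0) (hbd : ⟪b, d⟫ = 0) (hcd : ⟪c, d⟫ = 0) : d = 0 := by
  by_contra hd
  have hli : LinearIndependent ℝ ![a, b, c, d] := by
    apply linearIndependent_of_ne_zero_of_inner_eq_zero
    · intro i; fin_cases i <;> simpa
    · intro i j hij
      fin_cases i <;> fin_cases j <;>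
        first
        | exact absurd rfl hij
        | assumption
        | (rw [real_inner_comm]; assumption)
  simpa using hli.fintype_card_le_finrank

theorem exists_ne_zero_orthogonal_pair (a b : E3) :
    ∃ y : E3, y ≠ 0 ∧ ⟪a, y⟫ = 0 ∧ ⟪b, y⟫ = 0 := by
  let L : E3 →ₗ[ℝ] ℝ × ℝ := ((innerSL ℝ a).toLinearMap).prod ((innerSL ℝ b).toLinearMap)
  have hL : L.ker ≠ ⊥ := LinearMap.ker_ne_bot_of_finrank_lt (by simp)
  obtain ⟨y, hy, hy0⟩ := Submodule.exists_mem_ne_zero_of_ne_bot hL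
  have h : L y = 0 := hy
  exact ⟨y, hy0, congrArg Prod.fst h, congrArg Prod.snd h⟩

/-! ### Symmetry of second derivatives. -/

section SecondDerivative

variable {E F : Type*} [NormedAddCommGroup E] [NormedSpace ℝ E]
  [NormedAddCommGroup F] [NormedSpace ℝ F] {g : E → F} {z : E}

theorem differentiableAt_fderiv_apply (hg : ContDiffAt ℝ ∞ g z) (X : E) :
    DifferentiableAt ℝ (fun w => fderiv ℝ g w X) z :=
  ((hg.fderiv_right (m := 1) (by norm_cast)).differentiableAt (by simp)).clm_apply
    (differentiableAt_const X)

theorem fderiv_fderiv_apply (hg : ContDiffAt ℝ ∞ g z) (X Y : E) :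
    fderiv ℝ (fun w => fderiv ℝ g w X) z Y = fderiv ℝ (fderiv ℝ g) z Y X := by
  have h : DifferentiableAt ℝ (fderiv ℝ g) z :=
    (hg.fderiv_right (m := 1) (by norm_cast)).differentiableAt (by simp)
  simp [fderiv_clm_apply h (differentiableAt_const X)]

theorem fderiv_fderiv_comm (hg : ContDiffAt ℝ ∞ g z) (X Y : E) :
    fderiv ℝ (fun w => fderiv ℝ g w X) z Y = fderiv ℝ (fun w => fderiv ℝ g w Y) z X := by
  rw [fderiv_fderiv_apply hg, fderiv_fderiv_apply hg]
  exact (hg.isSymmSndFDerivAt (by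
    rw [minSmoothness_of_isRCLikeNormedField]
    exact WithTop.coe_le_coe.2 (le_top : (2 : ℕ∞) ≤ ⊤))).eq Y X

end SecondDerivative

/-! ### The anti-torqued field in space. -/

section Ambient

variable {Ω : Set E3} {V : E3 → E3} {f : E3 → ℝ}

theorem IsUnitAntiTorqued.fderiv_field (hV : IsUnitAntiTorqued Ω V f) {x : E3} (hx : x ∈ Ω)
    (X : E3) : fderiv ℝ V x X = f x • (X - ⟪V x, X⟫ • V x) := by
  rw [hV.torseForming.fderiv_eq x hx X]
  simp [smul_smul, sub_eq_add_neg]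

theorem IsUnitAntiTorqued.contDiffAt_field (hV : IsUnitAntiTorqued Ω V f) (hΩ : IsOpen Ω)
    {x : E3} (hx : x ∈ Ω) : ContDiffAt ℝ ∞ V x :=
  hV.torseForming.contDiffOn_field.contDiffAt (hΩ.mem_nhds hx)

theorem IsUnitAntiTorqued.contDiffAt_scalar (hV : IsUnitAntiTorqued Ω V f) (hΩ : IsOpen Ω)
    {x : E3} (hx : x ∈ Ω) : ContDiffAt ℝ ∞ f x :=
  hV.torseForming.contDiffOn_scalar.contDiffAt (hΩ.mem_nhds hx)

/-- The gradient of the conformal scalar is `-f² V`. -/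
theorem IsUnitAntiTorqued.fderiv_scalar (hV : IsUnitAntiTorqued Ω V f) (hΩ : IsOpen Ω)
    {x : E3} (hx : x ∈ Ω) (X : E3) : fderiv ℝ f x X = -(f x) ^ 2 * ⟪V x, X⟫ := by
  have hVx := hV.contDiffAt_field hΩ hx
  have dV : DifferentiableAt ℝ V x := hVx.differentiableAt (by simp)
  have df : DifferentiableAt ℝ f x := (hV.contDiffAt_scalar hΩ hx).differentiableAt (by simp)
  have key : ∀ A B : E3, fderiv ℝ (fun y => fderiv ℝ V y A) x B
      = fderiv ℝ f x B • (A - ⟪V x, A⟫ • V x)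
        - f x • (⟪fderiv ℝ V x B, A⟫ • V x + ⟪V x, A⟫ • fderiv ℝ V x B) := by
    intro A B
    have he : (fun y => fderiv ℝ V y A) =ᶠ[nhds x] fun y => f y • (A - ⟪V y, A⟫ • V y) := by
      filter_upwards [hΩ.mem_nhds hx] with y hy using hV.fderiv_field hy A
    rw [he.fderiv_eq]
    have h1 := dV.hasFDerivAt.inner ℝ (hasFDerivAt_const A x)
    have h2 := df.hasFDerivAt.smul ((hasFDerivAt_const A x).sub (h1.smul dV.hasFDerivAt))
    have h3 : HasFDerivAt (fun y => f y • (A - ⟪V y, A⟫ • V y)) _ x := h2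
    rw [h3.fderiv]
    simp
    module
  -- Pairing the symmetry of D²V(X, Y) with a vector Y orthogonal to both V and X leaves only
  -- df(X)|Y|² on one side and -f² ν(X)|Y|² on the other.
  obtain ⟨Y, hY0, hY1, hY2⟩ := exists_ne_zero_orthogonal_pair (V x) X
  have h := fderiv_fderiv_comm hVx X Y
  rw [key, key, hV.fderiv_field hx, hV.fderiv_field hx] at h
  have h' := congrArg (fun w => ⟪w, Y⟫) h
  have hYY : ⟪Y, Y⟫ ≠ 0 := by simpa using hY0
  have hYX : ⟪Y, X⟫ = 0 := by rw [real_inner_comm, hY2]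
  simp only [inner_add_left, inner_sub_left, inner_smul_left, hY1, hY2, hYX,
    conj_trivial] at h'
  have h4 : (fderiv ℝ f x X - -(f x) ^ 2 * ⟪V x, X⟫) * ⟪Y, Y⟫ = 0 := by
    linarith [h']
  have := (mul_eq_zero.mp h4).resolve_right hYY
  linarith

end Ambient

/-- Dimension count: the image of `L` and the orthogonal complement of `u` are both planes, and the
first lies in the second. -/
theorem exists_apply_eq_of_inner_eq_zero {L : E2 →ₗ[ℝ] E3} (hL : Function.Injective L) {u : E3}
    (hu : u ≠ 0) (hLu : ∀ X, ⟪u, L X⟫ = 0) {w : E3} (hw : ⟪u, w⟫ = 0) : ∃ X, L X = w := by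
  have hle : L.range ≤ (ℝ ∙ u)ᗮ := by
    rintro _ ⟨X, rfl⟩
    exact Submodule.mem_orthogonal_singleton_iff_inner_right.2 (hLu X)
  have h1 : Module.finrank ℝ L.range = 2 := by
    rw [LinearMap.finrank_range_of_inj hL]; simp
  have h2 : Module.finrank ℝ (ℝ ∙ u)ᗮ = 2 := by
    have : Fact (Module.finrank ℝ E3 = 2 + 1) := ⟨by simp⟩
    exact Submodule.finrank_orthogonal_span_singleton hu
  have heq := Submodule.eq_of_le_of_finrank_eq hle (h1.trans h2.symm)
  have : w ∈ L.range := by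
    rw [heq]; exact Submodule.mem_orthogonal_singleton_iff_inner_right.2 hw
  exact this

/-! ### Principal directions of a constant angle patch. -/

/-- The immersion `x` and the unit normal field `u` of a surface, written in local coordinates with
domain `W`, that makes the constant angle `θ` with the unit anti-torqued vector field `V`. -/
structure IsConstantAnglePatch (Ω : Set E3) (V : E3 → E3) (f : E3 → ℝ) (θ : ℝ) (W : Set E2)
    (x u : E2 → E3) : Prop where
  antiTorqued : IsUnitAntiTorqued Ω V f
  isOpen_ambient : IsOpen Ω
  isOpen_domain : IsOpen W
  contDiffOn_immersion : ContDiffOn ℝ ∞ x W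
  contDiffOn_normal : ContDiffOn ℝ ∞ u W
  injective_fderiv : ∀ z ∈ W, Function.Injective (fderiv ℝ x z)
  norm_normal : ∀ z ∈ W, ‖u z‖ = 1
  inner_normal : ∀ z ∈ W, ∀ X : E2, ⟪u z, fderiv ℝ x z X⟫ = 0
  mem_ambient : ∀ z ∈ W, x z ∈ Ω
  inner_eq : ∀ z ∈ W, ⟪u z, V (x z)⟫ = Real.cos θ
  sin_ne_zero : Real.sin θ ≠ 0

namespace IsConstantAnglePatch

variable {Ω : Set E3} {V : E3 → E3} {f : E3 → ℝ} {θ : ℝ} {W : Set E2} {x u : E2 → E3}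
  (P : IsConstantAnglePatch Ω V f θ W x u) {z : E2} (hz : z ∈ W)

include P hz

theorem contDiffAt_immersion : ContDiffAt ℝ ∞ x z :=
  P.contDiffOn_immersion.contDiffAt (P.isOpen_domain.mem_nhds hz)

theorem contDiffAt_normal : ContDiffAt ℝ ∞ u z :=
  P.contDiffOn_normal.contDiffAt (P.isOpen_domain.mem_nhds hz)

theorem contDiffAt_field : ContDiffAt ℝ ∞ (fun w => V (x w)) z :=
  (P.antiTorqued.contDiffAt_field P.isOpen_ambient (P.mem_ambient z hz)).comp z
    (P.contDiffAt_immersion hz)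

theorem contDiffAt_scalar : ContDiffAt ℝ ∞ (fun w => f (x w)) z :=
  (P.antiTorqued.contDiffAt_scalar P.isOpen_ambient (P.mem_ambient z hz)).comp z
    (P.contDiffAt_immersion hz)

theorem differentiableAt_immersion : DifferentiableAt ℝ x z :=
  (P.contDiffAt_immersion hz).differentiableAt (by simp)

theorem differentiableAt_normal : DifferentiableAt ℝ u z :=
  (P.contDiffAt_normal hz).differentiableAt (by simp)

theorem differentiableAt_field : DifferentiableAt ℝ (fun w => V (x w)) z :=
  (P.contDiffAt_field hz).differentiableAt (by simp)

theorem differentiableAt_scalar : DifferentiableAt ℝ (fun w => f (x w)) z :=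
  (P.contDiffAt_scalar hz).differentiableAt (by simp)

theorem normal_ne_zero : u z ≠ 0 := by
  intro h
  simpa [h] using P.norm_normal z hz

theorem inner_normal_self : ⟪u z, u z⟫ = 1 := by
  rw [real_inner_self_eq_norm_sq, P.norm_normal z hz]; norm_num

theorem inner_field_self : ⟪V (x z), V (x z)⟫ = 1 := by
  rw [real_inner_self_eq_norm_sq, P.antiTorqued.norm_eq_one _ (P.mem_ambient z hz)]; norm_num

theorem scalar_ne_zero : f (x z) ≠ 0 := P.antiTorqued.scalar_ne_zero _ (P.mem_ambient z hz)

theorem fderiv_field (X : E2) : fderiv ℝ (fun w => V (x w)) z X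
    = f (x z) • (fderiv ℝ x z X - ⟪V (x z), fderiv ℝ x z X⟫ • V (x z)) := by
  have h := fderiv_comp z ((P.antiTorqued.contDiffAt_field P.isOpen_ambient
    (P.mem_ambient z hz)).differentiableAt (by simp)) (P.differentiableAt_immersion hz)
  have h' : fderiv ℝ (fun w => V (x w)) z = _ := h
  rw [h', ContinuousLinearMap.comp_apply,
    P.antiTorqued.fderiv_field (P.mem_ambient z hz)]

theorem fderiv_scalar (X : E2) : fderiv ℝ (fun w => f (x w)) z X
    = -(f (x z)) ^ 2 * ⟪V (x z), fderiv ℝ x z X⟫ := by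
  have h := fderiv_comp z ((P.antiTorqued.contDiffAt_scalar P.isOpen_ambient
    (P.mem_ambient z hz)).differentiableAt (by simp)) (P.differentiableAt_immersion hz)
  have h' : fderiv ℝ (fun w => f (x w)) z = _ := h
  rw [h', ContinuousLinearMap.comp_apply,
    P.antiTorqued.fderiv_scalar P.isOpen_ambient (P.mem_ambient z hz)]

theorem inner_fderiv_normal (X : E2) : ⟪u z, fderiv ℝ u z X⟫ = 0 := by
  have he : (fun w => ⟪u w, u w⟫) =ᶠ[nhds z] fun _ => (1 : ℝ) := by
    filter_upwards [P.isOpen_domain.mem_nhds hz] with w hw using P.inner_normal_self hw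
  have h := fderiv_inner_apply ℝ (P.differentiableAt_normal hz) (P.differentiableAt_normal hz) X
  rw [he.fderiv_eq, real_inner_comm (u z)] at h
  simp at h
  linarith

/-- Derivative of the angle condition ⟨u, V⟩ = cos θ; the tangential part of dV is orthogonal to u,
so only the term -f ν(X) V contributes. -/
theorem inner_fderiv_normal_field (X : E2) : ⟪fderiv ℝ u z X, V (x z)⟫
    = Real.cos θ * f (x z) * ⟪V (x z), fderiv ℝ x z X⟫ := by
  have he : (fun w => ⟪u w, V (x w)⟫) =ᶠ[nhds z] fun _ => Real.cos θ := by
    filter_upwards [P.isOpen_domain.mem_nhds hz] with w hw using P.inner_eq w hw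
  have h := fderiv_inner_apply ℝ (P.differentiableAt_normal hz) (P.differentiableAt_field hz) X
  rw [he.fderiv_eq, P.fderiv_field hz, inner_smul_right, inner_sub_right, inner_smul_right,
    P.inner_normal z hz, P.inner_eq z hz] at h
  simp at h
  linarith

/-- The second fundamental form is symmetric. -/
theorem inner_fderiv_normal_comm (X Y : E2) : ⟪fderiv ℝ u z X, fderiv ℝ x z Y⟫
    = ⟪fderiv ℝ u z Y, fderiv ℝ x z X⟫ := by
  have key : ∀ X Y : E2, ⟪fderiv ℝ u z X, fderiv ℝ x z Y⟫
      = -⟪u z, fderiv ℝ (fun w => fderiv ℝ x w Y) z X⟫ := by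
    intro X Y
    have he : (fun w => ⟪u w, fderiv ℝ x w Y⟫) =ᶠ[nhds z] fun _ => (0 : ℝ) := by
      filter_upwards [P.isOpen_domain.mem_nhds hz] with w hw using P.inner_normal w hw Y
    have h := fderiv_inner_apply ℝ (P.differentiableAt_normal hz)
      (differentiableAt_fderiv_apply (P.contDiffAt_immersion hz) Y) X
    rw [he.fderiv_eq] at h
    simp at h
    linarith
  rw [key, key, fderiv_fderiv_comm (P.contDiffAt_immersion hz)]

theorem exists_fderiv_eq {w : E3} (hw : ⟪u z, w⟫ = 0) : ∃ X, fderiv ℝ x z X = w :=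
  exists_apply_eq_of_inner_eq_zero (L := (fderiv ℝ x z).toLinearMap) (P.injective_fderiv z hz)
    (P.normal_ne_zero hz) (P.inner_normal z hz) hw

theorem inner_normal_sub : ⟪u z, V (x z) - Real.cos θ • u z⟫ = 0 := by
  rw [inner_sub_right, inner_smul_right, P.inner_eq z hz, P.inner_normal_self hz]; ring

/-- The coordinate vector of the unit field `T = (V - cos θ U) / sin θ`. -/
theorem exists_axis : ∃ ξ, Real.sin θ • fderiv ℝ x z ξ = V (x z) - Real.cos θ • u z := by
  obtain ⟨ξ, hξ⟩ := P.exists_fderiv_eq hz (w := (Real.sin θ)⁻¹ • (V (x z) - Real.cos θ • u z))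
    (by rw [inner_smul_right, P.inner_normal_sub hz, mul_zero])
  exact ⟨ξ, by rw [hξ, smul_inv_smul₀ P.sin_ne_zero]⟩

theorem exists_cross : ∃ η, fderiv ℝ x z η ≠ 0 ∧ ⟪V (x z), fderiv ℝ x z η⟫ = 0 := by
  obtain ⟨y, hy0, hy1, hy2⟩ := exists_ne_zero_orthogonal_pair (u z) (V (x z))
  obtain ⟨η, rfl⟩ := P.exists_fderiv_eq hz hy1
  exact ⟨η, hy0, hy2⟩

section Axis

variable {ξ : E2} (hξ : Real.sin θ • fderiv ℝ x z ξ = V (x z) - Real.cos θ • u z)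

include hξ

theorem inner_field_eq_axis (X : E2) :
    ⟪V (x z), fderiv ℝ x z X⟫ = Real.sin θ * ⟪fderiv ℝ x z ξ, fderiv ℝ x z X⟫ := by
  have h : V (x z) = Real.sin θ • fderiv ℝ x z ξ + Real.cos θ • u z := by rw [hξ]; simp
  rw [h, inner_add_left, inner_smul_left, inner_smul_left, P.inner_normal z hz]
  simp

theorem inner_field_axis : ⟪V (x z), fderiv ℝ x z ξ⟫ = Real.sin θ := by
  have h : Real.sin θ * ⟪V (x z), fderiv ℝ x z ξ⟫ = Real.sin θ * Real.sin θ := by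
    rw [← inner_smul_right, hξ, inner_sub_right, inner_smul_right, P.inner_field_self hz,
      real_inner_comm, P.inner_eq z hz]
    nlinarith [Real.sin_sq_add_cos_sq θ]
  exact mul_left_cancel₀ P.sin_ne_zero h

theorem axis_ne_zero : fderiv ℝ x z ξ ≠ 0 := by
  intro h
  have := P.inner_field_axis hz hξ
  rw [h, inner_zero_right] at this
  exact P.sin_ne_zero this.symm

theorem inner_axis_eq_zero {η : E2} (hη : ⟪V (x z), fderiv ℝ x z η⟫ = 0) :
    ⟪fderiv ℝ x z ξ, fderiv ℝ x z η⟫ = 0 := by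
  rw [P.inner_field_eq_axis hz hξ] at hη
  exact (mul_eq_zero.1 hη).resolve_left P.sin_ne_zero

/-- The unit field `T` is principal. -/
theorem fderiv_normal_axis : fderiv ℝ u z ξ = (Real.cos θ * f (x z)) • fderiv ℝ x z ξ := by
  obtain ⟨η, hη0, hη⟩ := P.exists_cross hz
  have hin : ∀ Y, ⟪fderiv ℝ x z Y, fderiv ℝ u z ξ - (Real.cos θ * f (x z)) • fderiv ℝ x z ξ⟫
      = 0 := by
    intro Y
    -- Here sin θ T is replaced by V - cos θ u, and du(Y) is orthogonal to u. The symmetry of the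
    -- second fundamental form then moves the derivative from Y to ξ.
    have h1 : Real.sin θ * ⟪fderiv ℝ u z Y, fderiv ℝ x z ξ⟫
        = Real.sin θ * (Real.cos θ * f (x z) * ⟪fderiv ℝ x z ξ, fderiv ℝ x z Y⟫) := by
      rw [← inner_smul_right, hξ, inner_sub_right, inner_smul_right,
        P.inner_fderiv_normal_field hz, real_inner_comm (u z), P.inner_fderiv_normal hz,
        P.inner_field_eq_axis hz hξ]
      ring
    have h2 := mul_left_cancel₀ P.sin_ne_zero h1
    rw [inner_sub_right, inner_smul_right, real_inner_comm, P.inner_fderiv_normal_comm hz, h2,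
      real_inner_comm (fderiv ℝ x z ξ)]
    ring
  refine sub_eq_zero.1 (eq_zero_of_orthogonal_triple (P.normal_ne_zero hz) (P.axis_ne_zero hz hξ)
    hη0 (P.inner_normal z hz _) (P.inner_normal z hz _) (P.inner_axis_eq_zero hz hξ hη) ?_
    (hin _) (hin _))
  rw [inner_sub_right, inner_smul_right, P.inner_fderiv_normal hz, P.inner_normal z hz]
  ring

end Axis

/-- The direction orthogonal to `T` is principal. -/
theorem fderiv_normal_cross {η : E2} (hη0 : fderiv ℝ x z η ≠ 0)
    (hη : ⟪V (x z), fderiv ℝ x z η⟫ = 0) :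
    fderiv ℝ u z η = (⟪fderiv ℝ u z η, fderiv ℝ x z η⟫ / ⟪fderiv ℝ x z η, fderiv ℝ x z η⟫) •
      fderiv ℝ x z η := by
  obtain ⟨ξ, hξ⟩ := P.exists_axis hz
  have hηη : ⟪fderiv ℝ x z η, fderiv ℝ x z η⟫ ≠ 0 := by simpa using hη0
  refine sub_eq_zero.1 (eq_zero_of_orthogonal_triple (P.normal_ne_zero hz) (P.axis_ne_zero hz hξ)
    hη0 (P.inner_normal z hz _) (P.inner_normal z hz _) (P.inner_axis_eq_zero hz hξ hη) ?_ ?_ ?_)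
  · rw [inner_sub_right, inner_smul_right, P.inner_fderiv_normal hz, P.inner_normal z hz]
    ring
  -- By symmetry the T-component of du(η) is the η-component of du(ξ), which vanishes because T is
  -- principal.
  · rw [inner_sub_right, inner_smul_right, real_inner_comm, P.inner_fderiv_normal_comm hz,
      P.fderiv_normal_axis hz hξ, inner_smul_left, P.inner_axis_eq_zero hz hξ hη]
    simp
  · rw [inner_sub_right, inner_smul_right, real_inner_comm, div_mul_cancel₀ _ hηη, sub_self]

end IsConstantAnglePatch

/-! ### The second principal curvature and the Codazzi equation. -/

theorem hasDerivAt_vec_left (s t : ℝ) : HasDerivAt (fun r : ℝ => (!₂[r, t] : E2)) !₂[1, 0] s := by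
  have h : (fun r : ℝ => (!₂[r, t] : E2)) = fun r => r • (!₂[1, 0] : E2) + !₂[0, t] := by
    funext r; ext i; fin_cases i <;> simp
  rw [h]
  simpa using ((hasDerivAt_id s).smul_const (!₂[1, 0] : E2)).add_const !₂[0, t]

theorem hasDerivAt_vec_right (s t : ℝ) : HasDerivAt (fun r : ℝ => (!₂[s, r] : E2)) !₂[0, 1] t := by
  have h : (fun r : ℝ => (!₂[s, r] : E2)) = fun r => r • (!₂[0, 1] : E2) + !₂[s, 0] := by
    funext r; ext i; fin_cases i <;> simp
  rw [h]
  simpa using ((hasDerivAt_id t).smul_const (!₂[0, 1] : E2)).add_const !₂[s, 0]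

/-- The normal curvature of the immersion `x` with unit normal field `u` in the direction `η`. -/
noncomputable def normalCurvature (x u : E2 → E3) (η z : E2) : ℝ :=
  -(⟪fderiv ℝ u z η, fderiv ℝ x z η⟫ / ⟪fderiv ℝ x z η, fderiv ℝ x z η⟫)

namespace IsConstantAnglePatch

variable {Ω : Set E3} {V : E3 → E3} {f : E3 → ℝ} {θ : ℝ} {W : Set E2} {x u : E2 → E3}

variable (P : IsConstantAnglePatch Ω V f θ W x u)

include P

theorem fderiv_normal_eq_normalCurvature {z : E2} (hz : z ∈ W) {η : E2} (hη0 : η ≠ 0)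
    (hη : ⟪V (x z), fderiv ℝ x z η⟫ = 0) :
    fderiv ℝ u z η = -normalCurvature x u η z • fderiv ℝ x z η := by
  have h0 : fderiv ℝ x z η ≠ 0 := fun h => hη0 (P.injective_fderiv z hz (by rw [h, map_zero]))
  rw [normalCurvature, neg_neg]
  exact P.fderiv_normal_cross hz h0 hη

theorem differentiableAt_normalCurvature {z : E2} (hz : z ∈ W) {η : E2} (hη0 : η ≠ 0) :
    DifferentiableAt ℝ (normalCurvature x u η) z := by
  have h0 : fderiv ℝ x z η ≠ 0 := fun h => hη0 (P.injective_fderiv z hz (by rw [h, map_zero]))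
  have hx := differentiableAt_fderiv_apply (P.contDiffAt_immersion hz) η
  have hu := differentiableAt_fderiv_apply (P.contDiffAt_normal hz) η
  have h1 : ⟪fderiv ℝ x z η, fderiv ℝ x z η⟫ ≠ 0 := inner_self_ne_zero.2 h0
  exact ((hu.inner ℝ hx).mul ((hx.inner ℝ hx).inv h1)).neg

/-- The Codazzi equation along the axis direction, in coordinates with coordinate vectors `ξ`, `η`
for which `ξ` is the coordinate vector of `T` and `η` is orthogonal to it. -/
theorem fderiv_normalCurvature {ξ η : E2} (hη0 : η ≠ 0)
    (hξ : ∀ z ∈ W, Real.sin θ • fderiv ℝ x z ξ = V (x z) - Real.cos θ • u z)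
    (hη : ∀ z ∈ W, ⟪V (x z), fderiv ℝ x z η⟫ = 0) {z : E2} (hz : z ∈ W) :
    fderiv ℝ (normalCurvature x u η) z ξ = -(Real.sin θ)⁻¹ *
      (Real.cos θ * f (x z) + normalCurvature x u η z) *
      (Real.cos θ * normalCurvature x u η z + f (x z)) := by
  have h0 : fderiv ℝ x z η ≠ 0 := fun h => hη0 (P.injective_fderiv z hz (by rw [h, map_zero]))
  have hW := P.isOpen_domain.mem_nhds hz
  have dk := P.differentiableAt_normalCurvature hz hη0
  have dx := differentiableAt_fderiv_apply (P.contDiffAt_immersion hz)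
  have dg := P.differentiableAt_scalar hz
  have hUη := P.fderiv_normal_eq_normalCurvature hz hη0 (hη z hz)
  -- The equation `hξ` differentiated along η; ν(η) = 0 reduces dV(η) to f dx(η).
  have hx2 : Real.sin θ • fderiv ℝ (fun w => fderiv ℝ x w ξ) z η
      = (f (x z) + Real.cos θ * normalCurvature x u η z) • fderiv ℝ x z η := by
    have he : (fun w => Real.sin θ • fderiv ℝ x w ξ) =ᶠ[nhds z]
        fun w => V (x w) - Real.cos θ • u w := by
      filter_upwards [hW] with w hw using hξ w hw
    have h := congrArg (fun L : E2 →L[ℝ] E3 => L η) he.fderiv_eq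
    rw [fderiv_fun_const_smul (dx ξ), fderiv_fun_sub (P.differentiableAt_field hz)
      ((P.differentiableAt_normal hz).fun_const_smul _),
      fderiv_fun_const_smul (P.differentiableAt_normal hz)] at h
    simp only [sub_apply, smul_apply] at h
    rw [h, P.fderiv_field hz, hη z hz, hUη]
    module
  -- The factor f contributes no term, because df = -f² ν vanishes on η.
  have hu1 : fderiv ℝ (fun w => fderiv ℝ u w ξ) z η
      = (Real.cos θ * f (x z)) • fderiv ℝ (fun w => fderiv ℝ x w ξ) z η := by
    have he : (fun w => fderiv ℝ u w ξ) =ᶠ[nhds z]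
        fun w => (Real.cos θ * f (x w)) • fderiv ℝ x w ξ := by
      filter_upwards [hW] with w hw using P.fderiv_normal_axis hw (hξ w hw)
    rw [he.fderiv_eq, fderiv_fun_smul (dg.const_mul _) (dx ξ), fderiv_const_mul dg]
    simp [P.fderiv_scalar hz, hη z hz]
  have hu2 : fderiv ℝ (fun w => fderiv ℝ u w η) z ξ
      = -(normalCurvature x u η z • fderiv ℝ (fun w => fderiv ℝ x w η) z ξ
        + fderiv ℝ (normalCurvature x u η) z ξ • fderiv ℝ x z η) := by
    have he : (fun w => fderiv ℝ u w η) =ᶠ[nhds z]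
        fun w => -(normalCurvature x u η w • fderiv ℝ x w η) := by
      filter_upwards [hW] with w hw
      rw [P.fderiv_normal_eq_normalCurvature hw hη0 (hη w hw), neg_smul]
    rw [he.fderiv_eq, fderiv_fun_neg, fderiv_fun_smul dk (dx η)]
    simp
  -- With both mixed derivatives symmetrized, every term is a multiple of dx(η) ≠ 0, so the vector
  -- identity becomes a scalar one.
  rw [fderiv_fderiv_comm (P.contDiffAt_normal hz), hu1,
    fderiv_fderiv_comm (P.contDiffAt_immersion hz) η] at hu2
  have hx2' : fderiv ℝ (fun w => fderiv ℝ x w ξ) z η = ((Real.sin θ)⁻¹ *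
      (f (x z) + Real.cos θ * normalCurvature x u η z)) • fderiv ℝ x z η := by
    rw [mul_smul, ← hx2, inv_smul_smul₀ P.sin_ne_zero]
  rw [hx2', smul_smul, smul_smul, ← add_smul, ← neg_smul] at hu2
  have := smul_left_injective ℝ h0 hu2
  linarith

/-- In coordinates adapted to the axis, the conformal scalar depends only on the first one. -/
theorem scalar_eq_of_mem {I J : Set ℝ} (hJ : IsOpen J) (hJc : J.OrdConnected)
    (hW : W = {z : E2 | z 0 ∈ I ∧ z 1 ∈ J})
    (hη : ∀ z ∈ W, ⟪V (x z), fderiv ℝ x z !₂[0, 1]⟫ = 0) {s t t' : ℝ} (hs : s ∈ I)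
    (ht : t ∈ J) (ht' : t' ∈ J) : f (x !₂[s, t]) = f (x !₂[s, t']) := by
  have hd : ∀ r ∈ J, HasDerivAt (fun r : ℝ => f (x !₂[s, r])) 0 r := by
    intro r hr
    have hz : !₂[s, r] ∈ W := by rw [hW]; exact ⟨hs, hr⟩
    have h2 := (P.differentiableAt_scalar hz).hasFDerivAt.comp_hasDerivAt r (hasDerivAt_vec_right s r)
    rw [P.fderiv_scalar hz, hη _ hz, mul_zero] at h2
    exact h2
  exact hJ.is_const_of_deriv_eq_zero hJc.isPreconnected
    (fun r hr => (hd r hr).differentiableAt.differentiableWithinAt)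
    (fun r hr => (hd r hr).deriv) ht ht'

end IsConstantAnglePatch

/-! ### Construction of adapted coordinates. -/

/-- The inverse function theorem for a smooth map of the plane, with a rectangle as the image. -/
theorem exists_openPartialHomeomorph_rectangle {Ψ : E2 → E2} {W : Set E2} (hW : IsOpen W)
    (hΨ : ContDiffOn ℝ ∞ Ψ W) {z₀ : E2} (hz₀ : z₀ ∈ W)
    (hinj : Function.Injective (fderiv ℝ Ψ z₀)) :
    ∃ (ψ : OpenPartialHomeomorph E2 E2) (I J : Set ℝ), (∀ z, ψ z = Ψ z) ∧ z₀ ∈ ψ.source ∧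
      ψ.source ⊆ W ∧ ContDiffOn ℝ ∞ ψ ψ.source ∧ ContDiffOn ℝ ∞ ψ.symm ψ.target ∧
      (∀ z ∈ ψ.source, Function.Injective (fderiv ℝ Ψ z)) ∧
      IsOpen I ∧ IsOpen J ∧ I.OrdConnected ∧ J.OrdConnected ∧
      ψ.target = {w : E2 | w 0 ∈ I ∧ w 1 ∈ J} := by
  have hc : ∀ z ∈ W, ContDiffAt ℝ ∞ Ψ z := fun z hz => hΨ.contDiffAt (hW.mem_nhds hz)
  have hequiv : ∀ z, Function.Injective (fderiv ℝ Ψ z) →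
      ∃ L : E2 ≃L[ℝ] E2, (L : E2 →L[ℝ] E2) = fderiv ℝ Ψ z := by
    intro z hz
    refine ⟨(LinearEquiv.ofInjectiveEndo (fderiv ℝ Ψ z).toLinearMap hz).toContinuousLinearEquiv, ?_⟩
    ext X
    rfl
  obtain ⟨L₀, hL₀⟩ := hequiv z₀ hinj
  have hd₀ : HasFDerivAt Ψ (L₀ : E2 →L[ℝ] E2) z₀ := by
    rw [hL₀]; exact ((hc z₀ hz₀).differentiableAt (by simp)).hasFDerivAt
  let ψ₀ := (hc z₀ hz₀).toOpenPartialHomeomorph Ψ hd₀ (by simp)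
  have hcont : ContinuousOn (fderiv ℝ Ψ) W := hΨ.continuousOn_fderiv_of_isOpen hW (by simp)
  -- Shrinking to the open set where dΨ is invertible makes the inverse smooth on the whole target,
  -- not only at the image of z₀.
  let O : Set E2 := W ∩ fderiv ℝ Ψ ⁻¹' Set.range ((↑) : (E2 ≃L[ℝ] E2) → (E2 →L[ℝ] E2))
  have hO : IsOpen O := hcont.isOpen_inter_preimage hW ContinuousLinearEquiv.isOpen
  have hz₀O : z₀ ∈ O := ⟨hz₀, L₀, hL₀⟩
  let ψ₁ := ψ₀.restrOpen O hO
  have hs₁ : ψ₁.source ⊆ O := fun z hz => hz.2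
  have hz₁ : z₀ ∈ ψ₁.source :=
    ⟨(hc z₀ hz₀).mem_toOpenPartialHomeomorph_source hd₀ (by simp), hz₀O⟩
  have hψ₁ : ∀ z, ψ₁ z = Ψ z := fun z => rfl
  have hcv : Continuous (fun q : ℝ × ℝ => (!₂[q.1, q.2] : E2)) := by fun_prop
  -- Balls of the sup metric on ℝ × ℝ are rectangles, unlike the Euclidean balls of `E2`.
  have hnhds : (fun q : ℝ × ℝ => (!₂[q.1, q.2] : E2)) ⁻¹' ψ₁.target ∈ nhds (Ψ z₀ 0, Ψ z₀ 1) := by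
    refine (ψ₁.open_target.preimage hcv).mem_nhds ?_
    have : (!₂[Ψ z₀ 0, Ψ z₀ 1] : E2) = ψ₁ z₀ := by
      ext i; fin_cases i <;> rfl
    rw [Set.mem_preimage, this]
    exact ψ₁.map_source hz₁
  obtain ⟨ε, hε, hball⟩ := Metric.mem_nhds_iff.1 hnhds
  rw [← ball_prod_same] at hball
  let I := Metric.ball (Ψ z₀ 0) ε
  let J := Metric.ball (Ψ z₀ 1) ε
  let R : Set E2 := {w : E2 | w 0 ∈ I ∧ w 1 ∈ J}
  have hR : IsOpen R := (Metric.isOpen_ball.preimage (by fun_prop)).inter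
    (Metric.isOpen_ball.preimage (by fun_prop))
  have hRt : R ⊆ ψ₁.target := by
    intro w hw
    have h : (!₂[w 0, w 1] : E2) ∈ ψ₁.target := hball (Set.mk_mem_prod hw.1 hw.2)
    have hw' : (!₂[w 0, w 1] : E2) = w := by ext i; fin_cases i <;> rfl
    rwa [hw'] at h
  let ψ := (ψ₁.symm.restrOpen R hR).symm
  have hsrc : ψ.source ⊆ O := by
    intro z hz
    have hz' : ψ.symm (ψ z) = z := ψ.left_inv hz
    have hm : ψ z ∈ ψ.target := ψ.map_source hz
    rw [← hz']
    exact hs₁ (ψ₁.map_target hm.1)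
  have htgt : ψ.target = R := Set.inter_eq_right.2 hRt
  have hval : ∀ z, ψ z = Ψ z := fun z => rfl
  refine ⟨ψ, I, J, hval, ?_, fun z hz => (hsrc hz).1, ?_, ?_, ?_, Metric.isOpen_ball,
    Metric.isOpen_ball, ?_, ?_, htgt⟩
  · have : ψ.symm (Ψ z₀) = z₀ := ψ₁.left_inv hz₁
    rw [← this]
    refine ψ.map_target ?_
    rw [htgt]
    exact ⟨Metric.mem_ball_self hε, Metric.mem_ball_self hε⟩
  · exact hΨ.mono fun z hz => (hsrc hz).1
  · intro w hw
    have hm : ψ.symm w ∈ O := hsrc (ψ.map_target hw)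
    obtain ⟨L, hL⟩ := hm.2
    refine (ψ.contDiffAt_symm hw (f₀' := L) ?_ (hc _ hm.1)).contDiffWithinAt
    rw [hL]
    exact ((hc _ hm.1).differentiableAt (by simp)).hasFDerivAt
  · intro z hz
    obtain ⟨L, hL⟩ := (hsrc hz).2
    rw [← hL]
    exact L.injective
  · rw [show I = Set.Ioo _ _ from Real.ball_eq_Ioo _ _]; exact Set.ordConnected_Ioo
  · rw [show J = Set.Ioo _ _ from Real.ball_eq_Ioo _ _]; exact Set.ordConnected_Ioo

/-- A component of `U ∧ V`, a function constant along the integral curves of `T`. -/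
noncomputable def wedgeComponent (V : E3 → E3) (x u : E2 → E3) (a b : E3) (z : E2) : ℝ :=
  ⟪u z, a⟫ * ⟪V (x z), b⟫ - ⟪u z, b⟫ * ⟪V (x z), a⟫

namespace IsConstantAnglePatch

variable {Ω : Set E3} {V : E3 → E3} {f : E3 → ℝ} {θ : ℝ} {W : Set E2} {x u : E2 → E3}

variable (P : IsConstantAnglePatch Ω V f θ W x u)

include P

theorem contDiffAt_wedgeComponent (a b : E3) {z : E2} (hz : z ∈ W) :
    ContDiffAt ℝ ∞ (wedgeComponent V x u a b) z := by
  have hu := P.contDiffAt_normal hz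
  have hv := P.contDiffAt_field hz
  exact ((hu.inner ℝ contDiffAt_const).mul (hv.inner ℝ contDiffAt_const)).sub
    ((hu.inner ℝ contDiffAt_const).mul (hv.inner ℝ contDiffAt_const))

theorem fderiv_wedgeComponent (a b : E3) {z : E2} (hz : z ∈ W) (X : E2) :
    fderiv ℝ (wedgeComponent V x u a b) z X =
      ⟪fderiv ℝ u z X, a⟫ * ⟪V (x z), b⟫ - ⟪fderiv ℝ u z X, b⟫ * ⟪V (x z), a⟫ +
      (⟪u z, a⟫ * ⟪fderiv ℝ (fun w => V (x w)) z X, b⟫ -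
        ⟪u z, b⟫ * ⟪fderiv ℝ (fun w => V (x w)) z X, a⟫) := by
  have hu := (P.differentiableAt_normal hz).hasFDerivAt
  have hv := (P.differentiableAt_field hz).hasFDerivAt
  have hi : ∀ {g : E2 → E3} {g' : E2 →L[ℝ] E3} (c : E3), HasFDerivAt g g' z →
      HasFDerivAt (fun w => ⟪g w, c⟫) ((innerSL ℝ c).comp g') z := by
    intro g g' c hg
    have h := ((innerSL ℝ c).hasFDerivAt).comp z hg
    refine h.congr_of_eventuallyEq (Filter.Eventually.of_forall fun w => ?_)
    simp [real_inner_comm]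
  have h := ((hi a hu).mul (hi b hv)).sub ((hi b hu).mul (hi a hv))
  have h' : HasFDerivAt (wedgeComponent V x u a b) _ z := h
  rw [h'.fderiv]
  simp [real_inner_comm]
  ring

/-- Both U and V vary within their span: U turns at the rate f cos θ T and V at f(T - sin θ V). The
derivative of U ∧ V is therefore f(1 - sin² θ - cos² θ) U ∧ T = 0. -/
theorem fderiv_wedgeComponent_axis (a b : E3) {z : E2} (hz : z ∈ W) {ξ : E2}
    (hξ : Real.sin θ • fderiv ℝ x z ξ = V (x z) - Real.cos θ • u z) :
    fderiv ℝ (wedgeComponent V x u a b) z ξ = 0 := by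
  have hv : V (x z) = Real.sin θ • fderiv ℝ x z ξ + Real.cos θ • u z := by rw [hξ]; simp
  rw [P.fderiv_wedgeComponent a b hz, P.fderiv_normal_axis hz hξ, P.fderiv_field hz,
    P.inner_field_axis hz hξ, hv]
  simp only [inner_add_left, inner_sub_left, inner_smul_left, conj_trivial]
  have := Real.sin_sq_add_cos_sq θ
  linear_combination (f (x z) * (⟪u z, b⟫ * ⟪fderiv ℝ x z ξ, a⟫ -
    ⟪u z, a⟫ * ⟪fderiv ℝ x z ξ, b⟫)) * this

/-- If dU(η) = k dφ(η) with η orthogonal to T, then the derivative of U ∧ V along η is dφ(η) ∧ (kV -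
fU). Its factors are orthogonal and nonzero, so using them as a and b yields the product of their
squared norms. -/
theorem exists_wedgeComponent_ne_zero {z : E2} (hz : z ∈ W) : ∃ a b : E3, ∀ X,
    ⟪V (x z), fderiv ℝ x z X⟫ = 0 → fderiv ℝ (wedgeComponent V x u a b) z X = 0 → X = 0 := by
  obtain ⟨η, hη0, hη⟩ := P.exists_cross hz
  obtain ⟨ξ, hξ⟩ := P.exists_axis hz
  obtain ⟨k, hk⟩ : ∃ k : ℝ, fderiv ℝ u z η = k • fderiv ℝ x z η :=
    ⟨_, P.fderiv_normal_cross hz hη0 hη⟩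
  have hηη : ⟪fderiv ℝ x z η, fderiv ℝ x z η⟫ ≠ 0 := inner_self_ne_zero.2 hη0
  have hb : k • V (x z) - f (x z) • u z ≠ 0 := by
    intro h
    have h1 := congrArg (fun w => ⟪w, fderiv ℝ x z ξ⟫) h
    simp only [inner_sub_left, inner_smul_left, conj_trivial, inner_zero_left,
      P.inner_normal z hz, P.inner_field_axis hz hξ, mul_zero, sub_zero] at h1
    have hk0 := (mul_eq_zero.1 h1).resolve_right P.sin_ne_zero
    rw [hk0, zero_smul, zero_sub, neg_eq_zero, smul_eq_zero] at h
    exact h.elim (P.scalar_ne_zero hz) (P.normal_ne_zero hz)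
  refine ⟨fderiv ℝ x z η, k • V (x z) - f (x z) • u z, ?_⟩
  have key : fderiv ℝ (wedgeComponent V x u (fderiv ℝ x z η) (k • V (x z) - f (x z) • u z)) z η
      = ⟪fderiv ℝ x z η, fderiv ℝ x z η⟫ *
        ⟪k • V (x z) - f (x z) • u z, k • V (x z) - f (x z) • u z⟫ := by
    rw [P.fderiv_wedgeComponent _ _ hz, hk, P.fderiv_field hz, hη, P.inner_normal z hz]
    rw [inner_sub_left (k • V (x z)) (f (x z) • u z) (k • V (x z) - f (x z) • u z)]
    simp only [inner_smul_left, conj_trivial, zero_smul, sub_zero]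
    ring
  intro X hX hX'
  obtain ⟨m, hm⟩ : ∃ m : ℝ, X = m • η := by
    refine ⟨⟪fderiv ℝ x z X, fderiv ℝ x z η⟫ / ⟪fderiv ℝ x z η, fderiv ℝ x z η⟫, ?_⟩
    apply P.injective_fderiv z hz
    rw [map_smul]
    refine sub_eq_zero.1 (eq_zero_of_orthogonal_triple (P.normal_ne_zero hz)
      (P.axis_ne_zero hz hξ) hη0 (P.inner_normal z hz _) (P.inner_normal z hz _)
      (P.inner_axis_eq_zero hz hξ hη) ?_ ?_ ?_)
    · rw [inner_sub_right, inner_smul_right, P.inner_normal z hz, P.inner_normal z hz]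
      ring
    · rw [inner_sub_right, inner_smul_right, P.inner_axis_eq_zero hz hξ hη,
        P.inner_axis_eq_zero hz hξ hX]
      ring
    · rw [inner_sub_right, inner_smul_right, real_inner_comm, div_mul_cancel₀ _ hηη, sub_self]
  rw [hm, map_smul, key, smul_eq_mul] at hX'
  have hm0 := (mul_eq_zero.1 hX').resolve_right (mul_ne_zero hηη (inner_self_ne_zero.2 hb))
  rw [hm, hm0, zero_smul]

/-- Local coordinates adapted to the axis: `∂_s = T`, and `∂_t` is orthogonal to `T`. -/
theorem exists_adapted {z₀ : E2} (hz₀ : z₀ ∈ W) :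
    ∃ (ψ : OpenPartialHomeomorph E2 E2) (I J : Set ℝ), z₀ ∈ ψ.source ∧
      ψ.source ⊆ W ∧ ContDiffOn ℝ ∞ ψ ψ.source ∧ ContDiffOn ℝ ∞ ψ.symm ψ.target ∧
      IsOpen I ∧ IsOpen J ∧ I.OrdConnected ∧ J.OrdConnected ∧
      ψ.target = {w : E2 | w 0 ∈ I ∧ w 1 ∈ J} ∧
      ∀ w ∈ ψ.target,
        Real.sin θ • fderiv ℝ x (ψ.symm w) (fderiv ℝ ψ.symm w !₂[1, 0])
          = V (x (ψ.symm w)) - Real.cos θ • u (ψ.symm w) ∧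
        ⟪V (x (ψ.symm w)), fderiv ℝ x (ψ.symm w) (fderiv ℝ ψ.symm w !₂[0, 1])⟫ = 0 := by
  obtain ⟨a, b, hab⟩ := P.exists_wedgeComponent_ne_zero hz₀
  -- Since d(1/f) = ν, the first component has differential ν / sin θ, with value 1 on T and 0 on
  -- T^⊥.
  let Ψ : E2 → E2 := fun z => !₂[(Real.sin θ)⁻¹ * (f (x z))⁻¹, wedgeComponent V x u a b z]
  have hΨc : ∀ z ∈ W, ContDiffAt ℝ ∞ Ψ z := by
    intro z hz
    refine contDiffAt_euclidean.2 fun i => ?_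
    fin_cases i
    · exact contDiffAt_const.mul ((P.contDiffAt_scalar hz).inv (P.scalar_ne_zero hz))
    · exact P.contDiffAt_wedgeComponent a b hz
  have hΨd : ∀ z ∈ W, HasFDerivAt Ψ (fderiv ℝ Ψ z) z := fun z hz =>
    ((hΨc z hz).differentiableAt (by simp)).hasFDerivAt
  have hΨ0 : ∀ z ∈ W, ∀ X, fderiv ℝ Ψ z X 0
      = (Real.sin θ)⁻¹ * ⟪V (x z), fderiv ℝ x z X⟫ := by
    intro z hz X
    have h1 := (EuclideanSpace.proj (𝕜 := ℝ) (0 : Fin 2)).hasFDerivAt.comp z (hΨd z hz)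
    have h2 := ((hasDerivAt_inv (P.scalar_ne_zero hz)).comp_hasFDerivAt z
      (P.differentiableAt_scalar hz).hasFDerivAt).const_mul (Real.sin θ)⁻¹
    have h3 := congrArg (fun L : E2 →L[ℝ] ℝ => L X) (h1.unique h2)
    have h4 : fderiv ℝ Ψ z X 0 = _ := h3
    rw [h4]
    have := P.scalar_ne_zero hz
    change (Real.sin θ)⁻¹ * (-(f (x z) ^ 2)⁻¹ * fderiv ℝ (fun w => f (x w)) z X) = _
    rw [P.fderiv_scalar hz]
    field_simp
  have hΨ1 : ∀ z ∈ W, ∀ X, fderiv ℝ Ψ z X 1 = fderiv ℝ (wedgeComponent V x u a b) z X := by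
    intro z hz X
    have h1 := (EuclideanSpace.proj (𝕜 := ℝ) (1 : Fin 2)).hasFDerivAt.comp z (hΨd z hz)
    have h2 := ((P.contDiffAt_wedgeComponent a b hz).differentiableAt (by simp)).hasFDerivAt
    exact congrArg (fun L : E2 →L[ℝ] ℝ => L X) (h1.unique h2)
  have hinj : Function.Injective (fderiv ℝ Ψ z₀) := by
    refine (injective_iff_map_eq_zero _).2 fun X hX => hab X ?_ ?_
    · have h := hΨ0 z₀ hz₀ X
      rw [hX] at h
      exact (mul_eq_zero.1 h.symm).resolve_left (inv_ne_zero P.sin_ne_zero)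
    · rw [← hΨ1 z₀ hz₀ X, hX]
      rfl
  obtain ⟨ψ, I, J, hval, hmem, hsub, hc, hcs, hψinj, hI, hJ, hI', hJ', htgt⟩ :=
    exists_openPartialHomeomorph_rectangle P.isOpen_domain
      (fun z hz => (hΨc z hz).contDiffWithinAt) hz₀ hinj
  refine ⟨ψ, I, J, hmem, hsub, hc, hcs, hI, hJ, hI', hJ', htgt, fun w hw => ?_⟩
  have hzs := ψ.map_target hw
  have hz := hsub hzs
  have hright : ∀ X, fderiv ℝ Ψ (ψ.symm w) (fderiv ℝ ψ.symm w X) = X := by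
    have h1 := (hΨd _ hz).comp w (((hcs.contDiffAt (ψ.open_target.mem_nhds hw)).differentiableAt
      (by simp)).hasFDerivAt)
    have h2 : HasFDerivAt (Ψ ∘ ψ.symm) (ContinuousLinearMap.id ℝ E2) w := by
      refine (hasFDerivAt_id w).congr_of_eventuallyEq ?_
      filter_upwards [ψ.open_target.mem_nhds hw] with y hy
      rw [Function.comp_apply, ← hval, ψ.right_inv hy, id]
    intro X
    exact congrArg (fun L : E2 →L[ℝ] E2 => L X) (h1.unique h2)
  constructor
  · obtain ⟨ξ, hξ⟩ := P.exists_axis hz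
    have h : fderiv ℝ Ψ (ψ.symm w) ξ = !₂[1, 0] := by
      ext i
      fin_cases i
      · refine (hΨ0 _ hz ξ).trans ?_
        rw [P.inner_field_axis hz hξ, inv_mul_cancel₀ P.sin_ne_zero]
        rfl
      · exact (hΨ1 _ hz ξ).trans (P.fderiv_wedgeComponent_axis a b hz hξ)
    -- Both vectors are sent to (1, 0) by dΨ, which is injective on the whole source and not only at
    -- z₀.
    have h' : fderiv ℝ ψ.symm w !₂[1, 0] = ξ := hψinj _ hzs ((hright _).trans h.symm)
    rw [h', hξ]
  -- The first coordinate of dΨ(∂_t) = (0, 1) is ν(∂_t) / sin θ.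
  · have h := hΨ0 _ hz (fderiv ℝ ψ.symm w !₂[0, 1])
    rw [hright] at h
    exact (mul_eq_zero.1 h.symm).resolve_left (inv_ne_zero P.sin_ne_zero)

end IsConstantAnglePatch

/-! ### Passage from plane patches to the surface. -/

section Groupoid

variable {N : Type*} [TopologicalSpace N] [ChartedSpace E2 N]

/-- Composing a chart of the maximal atlas with a diffeomorphism between open sets of the plane gives
a chart of the maximal atlas. -/
theorem trans_mem_maximalAtlas {e : OpenPartialHomeomorph N E2}
    (he : e ∈ IsManifold.maximalAtlas (𝓡 2) ∞ N) {ψ : OpenPartialHomeomorph E2 E2}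
    (hψ : ContDiffOn ℝ ∞ ψ ψ.source) (hψ' : ContDiffOn ℝ ∞ ψ.symm ψ.target) :
    e ≫ₕ ψ ∈ IsManifold.maximalAtlas (𝓡 2) ∞ N := by
  have hG : ψ ∈ contDiffGroupoid ∞ (𝓡 2) := by
    rw [contDiffGroupoid, mem_groupoid_of_pregroupoid]
    simpa [contDiffPregroupoid] using And.intro hψ hψ'
  intro e' he'
  obtain ⟨h1, h2⟩ := he e' he'
  constructor
  · rw [OpenPartialHomeomorph.trans_symm_eq_symm_trans_symm, OpenPartialHomeomorph.trans_assoc]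
    exact (contDiffGroupoid ∞ (𝓡 2)).trans ((contDiffGroupoid ∞ (𝓡 2)).symm hG) h1
  · rw [← OpenPartialHomeomorph.trans_assoc]
    exact (contDiffGroupoid ∞ (𝓡 2)).trans h2 hG

end Groupoid

namespace OrientedSurface

variable {N : Type*} [TopologicalSpace N] [ChartedSpace E2 N] (S : OrientedSurface N)

theorem U_ne_zero (p : N) : S.U p ≠ 0 := by
  intro h
  simpa [h] using S.norm_U p

theorem inner_U_self (p : N) : ⟪S.U p, S.U p⟫ = 1 := by
  rw [real_inner_self_eq_norm_sq, S.norm_U p]; norm_num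

theorem dφ_tangential_eq_projection (p : N) (w : E3) :
    S.dφ p (S.tangential p w) = (LinearMap.range (S.dφ p)).orthogonalProjectionOnto w := by
  exact congrArg Subtype.val ((LinearEquiv.ofInjective (S.dφ p) (S.injective_dφ p)).apply_symm_apply
    ((LinearMap.range (S.dφ p)).orthogonalProjectionOnto w))

/-- The image of dφ is all of U^⊥, so the projection that defines `tangential` only removes the
normal component. -/
theorem dφ_tangential (p : N) (w : E3) :
    S.dφ p (S.tangential p w) = w - ⟪S.U p, w⟫ • S.U p := by
  rw [dφ_tangential_eq_projection]
  have h0 : ⟪S.U p, w - ⟪S.U p, w⟫ • S.U p⟫ = 0 := by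
    rw [inner_sub_right, inner_smul_right, S.inner_U_self]; ring
  obtain ⟨X, hX⟩ := exists_apply_eq_of_inner_eq_zero (L := S.dφ p) (S.injective_dφ p)
    (S.U_ne_zero p) (S.inner_U p) h0
  refine Submodule.eq_starProjection_of_mem_of_inner_eq_zero ⟨X, hX⟩ ?_
  rintro _ ⟨Y, rfl⟩
  rw [sub_sub_cancel, inner_smul_left]
  exact mul_eq_zero_of_right _ (S.inner_U p Y)

section ConstantAngle

variable {S} {Ω : Set E3} {V : E3 → E3} {f : E3 → ℝ} {θ : ℝ}

theorem IsConstantAngle.dφ_tangentPart (hN : S.IsConstantAngle Ω V θ) (p : N) :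
    S.dφ p (S.tangentPart V p) = V (S.φ p) - Real.cos θ • S.U p := by
  rw [tangentPart, S.dφ_tangential, hN.inner_eq]

theorem IsConstantAngle.metric_tangentPart (hV : IsUnitAntiTorqued Ω V f)
    (hN : S.IsConstantAngle Ω V θ) (p : N) :
    S.metric p (S.tangentPart V p) (S.tangentPart V p) = Real.sin θ ^ 2 := by
  rw [metric, hN.dφ_tangentPart, inner_sub_left, inner_sub_right, inner_sub_right, inner_smul_left,
    inner_smul_left, inner_smul_right, inner_smul_right, S.inner_U_self,
    real_inner_comm (S.U p), hN.inner_eq, real_inner_self_eq_norm_sq, hV.norm_eq_one _ (hN.mem p),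
    Real.sin_sq]
  simp
  ring

theorem IsConstantAngle.sin_ne_zero (hV : IsUnitAntiTorqued Ω V f)
    (hN : S.IsConstantAngle Ω V θ) (p : N) : Real.sin θ ≠ 0 := by
  intro h
  have h1 := hN.metric_tangentPart hV p
  rw [h, zero_pow two_ne_zero, metric, inner_self_eq_zero] at h1
  exact hN.tangentPart_ne_zero p (S.injective_dφ p (h1.trans (map_zero _).symm))

theorem IsConstantAngle.dφ_unitTangentPart (hV : IsUnitAntiTorqued Ω V f)
    (hN : S.IsConstantAngle Ω V θ) (p : N) :
    Real.sin θ • S.dφ p (S.unitTangentPart V p) = V (S.φ p) - Real.cos θ • S.U p := by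
  -- The norm of V^⊤ is sin θ itself and not just its absolute value, because θ lies in [0, π].
  rw [unitTangentPart, hN.metric_tangentPart hV, Real.sqrt_sq
    (Real.sin_nonneg_of_mem_Icc hN.angle_mem), map_smul, smul_inv_smul₀ (hN.sin_ne_zero hV p),
    hN.dφ_tangentPart]

/-- Turns ∂_s = T, an equation in the tangent space of N, into the equation in ℝ³ used by the plane
patches. -/
theorem IsConstantAngle.eq_unitTangentPart_iff (hV : IsUnitAntiTorqued Ω V f)
    (hN : S.IsConstantAngle Ω V θ) (p : N) (X : TangentSpace (𝓡 2) p) :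
    X = S.unitTangentPart V p ↔
      Real.sin θ • S.dφ p X = V (S.φ p) - Real.cos θ • S.U p := by
  refine ⟨fun h => h ▸ hN.dφ_unitTangentPart hV p, fun h => S.injective_dφ p ?_⟩
  rw [← hN.dφ_unitTangentPart hV p] at h
  exact smul_right_injective E3 (hN.sin_ne_zero hV p) h

end ConstantAngle

section Chart

variable {e : OpenPartialHomeomorph N E2}
  (he : e ∈ IsManifold.maximalAtlas (𝓡 2) ∞ N) {z : E2} (hz : z ∈ e.target)

include he

theorem mdifferentiable_of_mem_maximalAtlas : e.MDifferentiable (𝓡 2) (𝓡 2) :=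
  ⟨(contMDiffOn_of_mem_maximalAtlas he).mdifferentiableOn (by simp),
    (contMDiffOn_symm_of_mem_maximalAtlas he).mdifferentiableOn (by simp)⟩

include hz

theorem injective_mfderiv_symm : Function.Injective (mfderiv (𝓡 2) (𝓡 2) e.symm z) :=
  (mdifferentiable_of_mem_maximalAtlas he).symm.mfderiv_injective hz

theorem fderiv_comp_symm {g : N → E3} (hg : ContMDiff (𝓡 2) 𝓘(ℝ, E3) ∞ g) (X : E2) :
    fderiv ℝ (g ∘ e.symm) z X
      = mfderiv (𝓡 2) 𝓘(ℝ, E3) g (e.symm z) (mfderiv (𝓡 2) (𝓡 2) e.symm z X) := by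
  rw [← mfderiv_eq_fderiv]
  have h := mfderiv_comp z (hg.mdifferentiable (by simp) (e.symm z))
    ((mdifferentiable_of_mem_maximalAtlas he).mdifferentiableAt_symm hz)
  exact congrArg (fun L : E2 →L[ℝ] E3 => L X) h

theorem fderiv_φ_comp_symm (X : E2) : fderiv ℝ (S.φ ∘ e.symm) z X
      = S.dφ (e.symm z) (mfderiv (𝓡 2) (𝓡 2) e.symm z X) :=
  fderiv_comp_symm he hz S.contMDiff_φ X

theorem fderiv_U_comp_symm (X : E2) : fderiv ℝ (S.U ∘ e.symm) z X
      = S.dU (e.symm z) (mfderiv (𝓡 2) (𝓡 2) e.symm z X) :=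
  fderiv_comp_symm he hz S.contMDiff_U X

/-- Principal directions in coordinates. -/
theorem hasEigenvector_shapeOperator {κ : ℝ} {X : E2} (hX : X ≠ 0)
    (h : fderiv ℝ (S.U ∘ e.symm) z X = -κ • fderiv ℝ (S.φ ∘ e.symm) z X) :
    (S.shapeOperator (e.symm z)).HasEigenvector κ (mfderiv (𝓡 2) (𝓡 2) e.symm z X) := by
  rw [S.fderiv_φ_comp_symm he hz, S.fderiv_U_comp_symm he hz] at h
  refine ⟨Module.End.mem_eigenspace_iff.2 (S.injective_dφ _ ?_), fun h0 => hX ?_⟩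
  · have h1 : S.shapeOperator (e.symm z) (mfderiv (𝓡 2) (𝓡 2) e.symm z X)
        = -(S.tangential (e.symm z) (S.dU (e.symm z) (mfderiv (𝓡 2) (𝓡 2) e.symm z X))) := rfl
    rw [h1, map_neg, S.dφ_tangential, h, inner_smul_right, map_smul]
    have h2 : ⟪S.U (e.symm z), S.dφ (e.symm z) (mfderiv (𝓡 2) (𝓡 2) e.symm z X)⟫ = 0 :=
      S.inner_U _ _
    rw [h2]
    simp
  · exact injective_mfderiv_symm he hz (h0.trans (map_zero _).symm)

omit hz in
theorem contDiffOn_comp_symm {g : N → E3} (hg : ContMDiff (𝓡 2) 𝓘(ℝ, E3) ∞ g) :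
    ContDiffOn ℝ ∞ (g ∘ e.symm) e.target :=
  (hg.comp_contMDiffOn (contMDiffOn_symm_of_mem_maximalAtlas he)).contDiffOn

variable {S} {Ω : Set E3} {V : E3 → E3} {f : E3 → ℝ} {θ : ℝ}

-- Every chart of the maximal atlas reduces the surface to a patch. The point `p` guarantees sin θ ≠
-- 0, which follows from V^⊤ ≠ 0 at a point.
omit hz in
theorem IsConstantAngle.isConstantAnglePatch (hΩ : IsOpen Ω) (hV : IsUnitAntiTorqued Ω V f)
    (hN : S.IsConstantAngle Ω V θ)
    (p : N) :
    IsConstantAnglePatch Ω V f θ e.target (S.φ ∘ e.symm) (S.U ∘ e.symm) where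
  antiTorqued := hV
  isOpen_ambient := hΩ
  isOpen_domain := e.open_target
  contDiffOn_immersion := contDiffOn_comp_symm he S.contMDiff_φ
  contDiffOn_normal := contDiffOn_comp_symm he S.contMDiff_U
  injective_fderiv w hw X Y h := by
    rw [S.fderiv_φ_comp_symm he hw, S.fderiv_φ_comp_symm he hw] at h
    exact injective_mfderiv_symm he hw (S.injective_dφ _ h)
  norm_normal w _ := S.norm_U _
  inner_normal w hw X := by
    rw [S.fderiv_φ_comp_symm he hw]
    exact S.inner_U _ _
  mem_ambient w _ := hN.mem _
  inner_eq w _ := hN.inner_eq _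
  sin_ne_zero := hN.sin_ne_zero hV p

end Chart

end OrientedSurface

/-! ### Existence of adapted charts and the curvatures in them. -/

namespace OrientedSurface

variable {N : Type*} [TopologicalSpace N] [ChartedSpace E2 N] {S : OrientedSurface N}
  {Ω : Set E3} {V : E3 → E3} {f : E3 → ℝ} {θ : ℝ}

theorem exists_isAdaptedChart [IsManifold (𝓡 2) ∞ N] (hΩ : IsOpen Ω)
    (hV : IsUnitAntiTorqued Ω V f) (hN : S.IsConstantAngle Ω V θ) (p : N) :
    ∃ (e : OpenPartialHomeomorph N E2) (I J : Set ℝ),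
      p ∈ e.source ∧ S.IsAdaptedChart V e I J := by
  have he₀ : chartAt E2 p ∈ IsManifold.maximalAtlas (𝓡 2) ∞ N :=
    IsManifold.chart_mem_maximalAtlas p
  set e₀ := chartAt E2 p
  have P := hN.isConstantAnglePatch he₀ hΩ hV p
  have hp : p ∈ e₀.source := mem_chart_source E2 p
  obtain ⟨ψ, I, J, hmem, hsub, hc, hcs, hI, hJ, hI', hJ', htgt, hψ⟩ :=
    P.exists_adapted (e₀.map_source hp)
  have he := trans_mem_maximalAtlas he₀ hc hcs
  have het : (e₀ ≫ₕ ψ).target = ψ.target := by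
    rw [OpenPartialHomeomorph.trans_target]
    exact Set.inter_eq_left.2 fun w hw => hsub (ψ.map_target hw)
  have hd : ∀ w ∈ ψ.target, ∀ X : E2,
      S.dφ ((e₀ ≫ₕ ψ).symm w) (mfderiv (𝓡 2) (𝓡 2) (e₀ ≫ₕ ψ).symm w X)
        = fderiv ℝ (S.φ ∘ e₀.symm) (ψ.symm w) (fderiv ℝ ψ.symm w X) := by
    intro w hw X
    rw [← S.fderiv_φ_comp_symm he (het ▸ hw)]
    have h := fderiv_comp w (P.differentiableAt_immersion (hsub (ψ.map_target hw)))
      ((hcs.contDiffAt (ψ.open_target.mem_nhds hw)).differentiableAt (by simp))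
    exact congrArg (fun L : E2 →L[ℝ] E3 => L X) h
  have hm : ∀ s ∈ I, ∀ t ∈ J, (!₂[s, t] : E2) ∈ ψ.target := by
    intro s hs t ht
    rw [htgt]
    exact ⟨hs, ht⟩
  refine ⟨e₀ ≫ₕ ψ, I, J, ?_, he, hI, hJ, hI', hJ', het.trans htgt, ?_, ?_⟩
  · rw [OpenPartialHomeomorph.trans_source]
    exact ⟨hp, hmem⟩
  · intro s hs t ht
    rw [hN.eq_unitTangentPart_iff hV]
    exact (congrArg _ (hd _ (hm s hs t ht) _)).trans (hψ _ (hm s hs t ht)).1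
  · intro s hs t ht
    have hw := hm s hs t ht
    refine (congrArg₂ (fun a b : E3 => ⟪a, b⟫) (hd _ hw _) (hd _ hw _)).trans ?_
    exact P.inner_axis_eq_zero (hsub (ψ.map_target hw)) (hψ _ hw).1 (hψ _ hw).2

theorem IsAdaptedChart.exists_curvatures (hΩ : IsOpen Ω)
    (hV : IsUnitAntiTorqued Ω V f) (hN : S.IsConstantAngle Ω V θ)
    {e : OpenPartialHomeomorph N E2} {I J : Set ℝ} (hA : S.IsAdaptedChart V e I J) :
    ∃ (F κ₁ : ℝ → ℝ) (κ₂ : ℝ → ℝ → ℝ), ∀ s ∈ I, ∀ t ∈ J,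
      f (S.φ (chartPoint e s t)) = F s ∧
      (S.shapeOperator (chartPoint e s t)).HasEigenvector (κ₁ s) (chartS e s t) ∧
      (S.shapeOperator (chartPoint e s t)).HasEigenvector (κ₂ s t) (chartT e s t) ∧
      κ₁ s = -Real.cos θ * F s ∧
      HasDerivAt (fun s' => κ₂ s' t)
        (-(Real.sin θ)⁻¹ * (Real.cos θ * F s + κ₂ s t) * (Real.cos θ * κ₂ s t + F s)) s := by
  -- An actual point of the rectangle is needed twice: to have sin θ ≠ 0, and to define F by
  -- freezing t at t₀. On an empty rectangle the claim is vacuous.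
  by_cases hne : ∃ s₀ t₀, s₀ ∈ I ∧ t₀ ∈ J
  swap
  · exact ⟨0, 0, 0, fun s hs t ht => (hne ⟨s, t, hs, ht⟩).elim⟩
  obtain ⟨s₀, t₀, -, ht₀⟩ := hne
  have he := hA.mem_maximalAtlas
  have P := hN.isConstantAnglePatch he hΩ hV (chartPoint e s₀ t₀)
  have hvec : ∀ z : E2, (!₂[z 0, z 1] : E2) = z := by
    intro z
    ext i; fin_cases i <;> rfl
  have hξ : ∀ z ∈ e.target, Real.sin θ • fderiv ℝ (S.φ ∘ e.symm) z !₂[1, 0]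
      = V ((S.φ ∘ e.symm) z) - Real.cos θ • (S.U ∘ e.symm) z := by
    intro z hz
    have hz' := hz
    rw [hA.target_eq] at hz'
    have h := (hN.eq_unitTangentPart_iff hV _ _).1 (hA.chartS_eq _ hz'.1 _ hz'.2)
    unfold chartS chartPoint at h
    rw [hvec z] at h
    rw [S.fderiv_φ_comp_symm he hz]
    exact h
  have hη : ∀ z ∈ e.target,
      ⟪V ((S.φ ∘ e.symm) z), fderiv ℝ (S.φ ∘ e.symm) z !₂[0, 1]⟫ = 0 := by
    intro z hz
    have hz' := hz
    rw [hA.target_eq] at hz'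
    have h := hA.orthogonal _ hz'.1 _ hz'.2
    unfold metric chartS chartT chartPoint at h
    rw [hvec z] at h
    rw [P.inner_field_eq_axis hz (hξ z hz), S.fderiv_φ_comp_symm he hz,
      S.fderiv_φ_comp_symm he hz]
    exact mul_eq_zero_of_right _ h
  have h10 : (!₂[1, 0] : E2) ≠ 0 := fun h => by simpa using congrArg (fun v : E2 => v 0) h
  have h01 : (!₂[0, 1] : E2) ≠ 0 := fun h => by simpa using congrArg (fun v : E2 => v 1) h
  refine ⟨fun s => f (S.φ (chartPoint e s t₀)),
    fun s => -Real.cos θ * f (S.φ (chartPoint e s t₀)),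
    fun s t => normalCurvature (S.φ ∘ e.symm) (S.U ∘ e.symm) !₂[0, 1] !₂[s, t], ?_⟩
  intro s hs t ht
  have hz : (!₂[s, t] : E2) ∈ e.target := by
    rw [hA.target_eq]
    exact ⟨hs, ht⟩
  have hF : f (S.φ (chartPoint e s t)) = f (S.φ (chartPoint e s t₀)) :=
    P.scalar_eq_of_mem hA.isOpen_right hA.ordConnected_right hA.target_eq hη hs ht ht₀
  refine ⟨hF, ?_, ?_, rfl, ?_⟩
  · refine hasEigenvector_shapeOperator S he hz h10 ?_
    simp only [← hF, neg_mul, neg_neg]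
    rw [P.fderiv_normal_axis hz (hξ _ hz)]
    rfl
  · exact hasEigenvector_shapeOperator S he hz h01
      (P.fderiv_normal_eq_normalCurvature hz h01 (hη _ hz))
  · have h := (P.differentiableAt_normalCurvature hz h01).hasFDerivAt.comp_hasDerivAt s
      (hasDerivAt_vec_left s t)
    rw [P.fderiv_normalCurvature h01 hξ hη hz] at h
    simp only [← hF]
    exact h

end OrientedSurface

theorem corollary3p4 {N : Type*} [TopologicalSpace N] [ChartedSpace E2 N]
    [IsManifold (𝓡 2) ∞ N] (S : OrientedSurface N)
    (Ω : Set E3) (hΩ : IsOpen Ω) (V : E3 → E3) (f : E3 → ℝ)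
    (hV : IsUnitAntiTorqued Ω V f) (θ : ℝ) (hN : S.IsConstantAngle Ω V θ)
    (hθ : Real.cos θ ≠ 0) :
    (∀ p : N, ∃ (e : OpenPartialHomeomorph N E2) (I J : Set ℝ),
      p ∈ e.source ∧ S.IsAdaptedChart V e I J) ∧
    ∀ (e : OpenPartialHomeomorph N E2) (I J : Set ℝ), S.IsAdaptedChart V e I J →
      ∃ (F κ₁ : ℝ → ℝ) (κ₂ : ℝ → ℝ → ℝ), ∀ s ∈ I, ∀ t ∈ J,
        f (S.φ (chartPoint e s t)) = F s ∧
        (S.shapeOperator (chartPoint e s t)).HasEigenvector (κ₁ s) (chartS e s t) ∧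
        (S.shapeOperator (chartPoint e s t)).HasEigenvector (κ₂ s t) (chartT e s t) ∧
        κ₁ s = -Real.cos θ * F s ∧
        HasDerivAt (fun s' => κ₂ s' t)
          (-(Real.sin θ)⁻¹ * (Real.cos θ * F s + κ₂ s t) * (Real.cos θ * κ₂ s t + F s)) s :=
  ⟨fun p => OrientedSurface.exists_isAdaptedChart hΩ hV hN p,
    fun _ _ _ hA => hA.exists_curvatures hΩ hV hN⟩
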